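/- Let $M$ be a smooth manifold of dimension $n$, $A^k(M)=\Gamma(\wedge^kTM)$, $\mathcal A(M)=\bigoplus_k A^k(M)$ (with $A^{-1}(M)=0$), and for $X\in A^k(M)$, $f\in C^\infty(M)$ let $[X,f]\in A^{k-1}(M)$ be the Schouten–Nijenhuis bracket, i.e. $[X_1\wedge\cdots\wedge X_k,f]=\sum_j(-1)^{k-j}(X_jf)\,X_1\wedge\cdots\widehat{X_j}\cdots\wedge X_k$. A *higher connection* on $M$ is a map $\nabla:\mathcal A(M)\times\mathcal A(M)\to\mathcal A(M)$, additive in both arguments and $C^\infty(M)$-linear in the first, with $\nabla_XY\in A^{k+l-1}(M)$, $\nabla_Xf=[X,f]$, $\nabla_X(fY)=[X,f]\wedge Y+f\nabla_XY$ and $\nabla_fX=0$. It is *induced* if $\nabla_{X\wedge Y}Z=X\wedge\nabla_YZ+(-1)^{kl}Y\wedge\nabla_XZ$ and $\nabla_X(Y\wedge Z)=(\nabla_XY)\wedge Z+(-1)^{(k-1)l}Y\wedge\nabla_XZ$ for $X\in A^k(M)$, $Y\in A^l(M)$, $Z\in\mathcal A(M)$; every affine connection $\widetilde\nabla$ on $TM$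 extends uniquely to an induced higher connection, also denoted $\widetilde\nabla$. The *data* of a higher connection $\nabla$ is the unique pair $(\widetilde\nabla,\{F^{k,l}\})$ of an affine connection $\widetilde\nabla$ on $TM$ and sections $F^{k,l}$ of $\wedge^{k+l-1}TM\otimes\wedge^kT^*M\otimes\wedge^lT^*M$ ($k,l>0$, $k+l-1\le n$; $F^{k,l}:=0$ for other $k,l$) with $F^{1,1}=0$ and $\nabla_XY=\widetilde\nabla_XY+F^{k,l}(X,Y)$ for all $X\in A^k(M)$, $Y\in A^l(M)$. For a higher connection $\nabla$, $X\in A^k(M)$ with $k>0$, $\omega\in\Omega^t(M)$ with $t-k+1\ge0$, and $Y\in A^{t-k+1}(M)$, put $$(\nabla_X\omega)(Y)=(-1)^{(k-1)(t-1)}L_Xi_Y\omega-\omega(\nabla_XY),$$ where $(i_Y\omega)(Z)=\omega(Y\wedge Z)$ and $L_X=d\,i_X-(-1)^ki_X\,d$. Let $\eta$ be a smooth fiberwise bilinear form on $\wedge^\bullet TM$ that is associative, $\eta(x\wedge y,z)=\eta(x,y\wedge z)$, and let $\omega^{(t)}\in\Omega^t(M)$, $0\le t\le n$, be the associated forms,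 determined by $\eta(x,y)=\omega^{(k+l)}(x\wedge y)$ for $x\in\wedge^kT_pM$, $y\in\wedge^lT_pM$, $k+l\le n$. For $X\in A^k(M)$, $Y\in A^l(M)$, $Z\in A^m(M)$ with $k>0$ and $k+l+m\le n+1$ put $(\nabla_X\eta)(Y,Z)=(\nabla_X\omega^{(k+l+m-1)})(Y\wedge Z)$. One writes $\nabla\eta\equiv0$ if $(\nabla_X\eta)(Y,Z)=0$ for all such $X,Y,Z$ with $l+m>0$. **Proposition.** Let $\eta$ be as above with associated forms $\{\omega^{(t)}\}$, and let $\nabla$ be a higher connection on $M$ with data $(\widetilde\nabla,\{F^{k,l}\})$. Then $\nabla\eta\equiv0$ if and only if $$(\widetilde\nabla_X\omega^{(t)})(Y)=\omega^{(t)}(F^{k,l}(X,Y))$$ for all $X\in A^k(M)$, $Y\in A^l(M)$ with $k,l>0$ and $t=k+l-1\le n$. -/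

import Mathlib

open scoped Manifold ContDiff

noncomputable section

namespace HigherConnections

/-- The `ℝ`-linear differential at `q` of the chart of `M` centred at `p`. -/
def chartDeriv (n : ℕ) (M : Type*) [TopologicalSpace M]
    [ChartedSpace (EuclideanSpace ℝ (Fin n)) M] (p q : M) :
    TangentSpace (𝓡 n) q →L[ℝ] EuclideanSpace ℝ (Fin n) :=
  mfderiv (𝓡 n) 𝓘(ℝ, EuclideanSpace ℝ (Fin n)) (extChartAt (𝓡 n) p) q

/-- The `ℝ`-linear differential at `y` of the inverse of the chart of `M` centred at `p`. -/
def chartSymmDeriv (n : ℕ) (M : Type*) [TopologicalSpace M]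
    [ChartedSpace (EuclideanSpace ℝ (Fin n)) M] (p : M) (y : EuclideanSpace ℝ (Fin n)) :
    EuclideanSpace ℝ (Fin n) →L[ℝ] TangentSpace (𝓡 n) ((extChartAt (𝓡 n) p).symm y) :=
  mfderiv 𝓘(ℝ, EuclideanSpace ℝ (Fin n)) (𝓡 n) (extChartAt (𝓡 n) p).symm y

/-- A section `X` of the full exterior bundle `⋀ TM` is smooth if in each chart all of its
coordinates (with respect to the constant vector space `⋀ ℝⁿ`) are smooth functions. -/
def IsSmoothMV (n : ℕ) (M : Type*) [TopologicalSpace M]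
    [ChartedSpace (EuclideanSpace ℝ (Fin n)) M]
    (X : ∀ p : M, ExteriorAlgebra ℝ (TangentSpace (𝓡 n) p)) : Prop :=
  ∀ (p : M) (φ : Module.Dual ℝ (ExteriorAlgebra ℝ (EuclideanSpace ℝ (Fin n)))),
    ContMDiffOn (𝓡 n) 𝓘(ℝ) ∞
      (fun q ↦ φ (ExteriorAlgebra.map (chartDeriv n M p q).toLinearMap (X q)))
      (extChartAt (𝓡 n) p).source

/-- The algebra `𝒜(M)` of (smooth) multivector fields, i.e. of smooth sections of `⋀ TM`, with the
pointwise exterior product. -/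
def MVField (n : ℕ) (M : Type*) [TopologicalSpace M]
    [ChartedSpace (EuclideanSpace ℝ (Fin n)) M] :
    Subalgebra ℝ (∀ p : M, ExteriorAlgebra ℝ (TangentSpace (𝓡 n) p)) where
  carrier := {X | IsSmoothMV n M X}
  add_mem' := by
    intro X Y hX hY p φ
    simp only [Pi.add_apply, map_add]
    exact (hX p φ).add (hY p φ)
  mul_mem' := by
    intro X Y hX hY p φ
    let b := (EuclideanSpace.basisFun (Fin n) ℝ).toBasis.ExteriorAlgebra
    have key : ∀ x y : ExteriorAlgebra ℝ (EuclideanSpace ℝ (Fin n)),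
        φ (x * y) = ∑ s, ∑ t, b.coord s x * b.coord t y * φ (b s * b t) := by
      intro x y
      conv_lhs => rw [← b.sum_repr x, ← b.sum_repr y]
      rw [Finset.sum_mul_sum]
      simp only [smul_mul_assoc, mul_smul_comm, map_sum, map_smul, smul_eq_mul,
        Module.Basis.coord_apply]
      refine Finset.sum_congr rfl fun s _ ↦ Finset.sum_congr rfl fun t _ ↦ ?_
      ring
    have e : (fun q ↦ φ (ExteriorAlgebra.map (chartDeriv n M p q).toLinearMap ((X * Y) q))) =
        fun q ↦ ∑ s, ∑ t,
          b.coord s (ExteriorAlgebra.map (chartDeriv n M p q).toLinearMap (X q)) *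
          b.coord t (ExteriorAlgebra.map (chartDeriv n M p q).toLinearMap (Y q)) *
          φ (b s * b t) := by
      funext q
      rw [Pi.mul_apply, map_mul, key]
    rw [e]
    refine contMDiffOn_finsetSum fun s _ ↦ contMDiffOn_finsetSum fun t _ ↦ ?_
    exact ((hX p (b.coord s)).mul (hY p (b.coord t))).mul contMDiffOn_const
  algebraMap_mem' := by
    intro r p φ
    simpa [Algebra.algebraMap_eq_smul_one] using contMDiffOn_const

/-- `A^k(M)`: the `k`-vector fields. -/
def KVField (n : ℕ) (M : Type*) [TopologicalSpace M]
    [ChartedSpace (EuclideanSpace ℝ (Fin n)) M] (k : ℕ) : Submodule ℝ (MVField n M) where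
  carrier := {X | ∀ p, X.1 p ∈ ⋀[ℝ]^k (TangentSpace (𝓡 n) p)}
  add_mem' := fun hX hY p ↦ Submodule.add_mem _ (hX p) (hY p)
  zero_mem' := fun _ ↦ Submodule.zero_mem _
  smul_mem' := fun c _ hX p ↦ Submodule.smul_mem _ c (hX p)

/-- A smooth function regarded as an element of `A^0(M) ⊆ 𝒜(M)`.  The product of a function `f` with
a multivector field `X` is `ofFun f * X`. -/
def ofFun {n : ℕ} {M : Type*} [TopologicalSpace M]
    [ChartedSpace (EuclideanSpace ℝ (Fin n)) M] (f : C^∞⟮𝓡 n, M; ℝ⟯) : MVField n M :=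
  ⟨fun p ↦ algebraMap ℝ _ (f p), by
    intro p φ
    simp only [AlgHom.commutes]
    simp only [Algebra.algebraMap_eq_smul_one, map_smul, smul_eq_mul]
    exact (f.contMDiff.contMDiffOn).mul contMDiffOn_const⟩

/-- The Schouten–Nijenhuis bracket `[X, f]` of a multivector field with a function: the
contraction of `X` with `df` from the right.  For `X = X₁ ∧ ⋯ ∧ X_k` it is
`∑ⱼ (-1)^(k-j) (Xⱼ f) X₁ ∧ ⋯ ∧ X̂ⱼ ∧ ⋯ ∧ X_k`, and it vanishes for `k = 0`. -/
def bracketFun {n : ℕ} {M : Type*} [TopologicalSpace M]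
    [ChartedSpace (EuclideanSpace ℝ (Fin n)) M] (X : MVField n M) (f : C^∞⟮𝓡 n, M; ℝ⟯) (p : M) :
    ExteriorAlgebra ℝ (TangentSpace (𝓡 n) p) :=
  CliffordAlgebra.contractRight (X.1 p) (mvfderiv (𝓡 n) f p).toLinearMap

/-- A higher affine connection on `M`.  In `map_mem`, `A^{-1}(M) = 0` for `k = l = 0` is covered
by `fun_left`. -/
structure HigherConnection (n : ℕ) (M : Type*) [TopologicalSpace M]
    [ChartedSpace (EuclideanSpace ℝ (Fin n)) M] where
  toFun : MVField n M → MVField n M → MVField n M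
  map_mem : ∀ (k l : ℕ), ∀ X ∈ KVField n M k, ∀ Y ∈ KVField n M l,
    toFun X Y ∈ KVField n M (k + l - 1)
  smul_add_left : ∀ (f : C^∞⟮𝓡 n, M; ℝ⟯) (X X' Y : MVField n M),
    toFun (ofFun f * X + X') Y = ofFun f * toFun X Y + toFun X' Y
  add_right : ∀ X Y Y' : MVField n M, toFun X (Y + Y') = toFun X Y + toFun X Y'
  fun_right : ∀ k, ∀ X ∈ KVField n M k, ∀ f : C^∞⟮𝓡 n, M; ℝ⟯,
    ∀ p, (toFun X (ofFun f)).1 p = bracketFun X f p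
  leibniz : ∀ k, ∀ X ∈ KVField n M k, ∀ (f : C^∞⟮𝓡 n, M; ℝ⟯) (Y : MVField n M),
    ∀ p, (toFun X (ofFun f * Y)).1 p = bracketFun X f p * Y.1 p + f p • (toFun X Y).1 p
  fun_left : ∀ (f : C^∞⟮𝓡 n, M; ℝ⟯) (X : MVField n M), toFun (ofFun f) X = 0

/-- A higher connection is induced if it is a derivation in both arguments. -/
def HigherConnection.IsInduced {n : ℕ} {M : Type*} [TopologicalSpace M]
    [ChartedSpace (EuclideanSpace ℝ (Fin n)) M] (C : HigherConnection n M) : Prop :=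
  ∀ k l : ℕ, ∀ X ∈ KVField n M k, ∀ Y ∈ KVField n M l, ∀ Z : MVField n M,
    C.toFun (X * Y) Z = X * C.toFun Y Z + (-1 : ℝ) ^ (k * l) • (Y * C.toFun X Z) ∧
    C.toFun X (Y * Z) = C.toFun X Y * Z + (-1 : ℝ) ^ (((k : ℤ) - 1) * l) • (Y * C.toFun X Z)

/-- `C` is the induced higher connection that extends the affine connection `D` on `TM`: it is
induced, and `C_V W = D_V W` for all vector fields `V`, `W`.
Mathlib writes `D W p (V p)` for `(D_V W)(p)`. -/
def HigherConnection.IsInducedBy {n : ℕ} {M : Type*} [TopologicalSpace M]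
    [ChartedSpace (EuclideanSpace ℝ (Fin n)) M] [IsManifold (𝓡 n) ∞ M] (C : HigherConnection n M)
    (D : CovariantDerivative (𝓡 n) (EuclideanSpace ℝ (Fin n))
      (fun p : M ↦ TangentSpace (𝓡 n) p)) : Prop :=
  C.IsInduced ∧
    ∀ (V W : ∀ p : M, TangentSpace (𝓡 n) p) (X Y : MVField n M),
      (∀ p, X.1 p = ExteriorAlgebra.ι ℝ (V p)) → (∀ p, Y.1 p = ExteriorAlgebra.ι ℝ (W p)) →
      ∀ p, (C.toFun X Y).1 p = ExteriorAlgebra.ι ℝ (D W p (V p))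

/-- A family of twist fields: sections `F^{k,l}` of `⋀^{k+l-1} TM ⊗ ⋀^k T*M ⊗ ⋀^l T*M` with
`F^{1,1} = 0`, for `k, l > 0` and `k + l - 1 ≤ n`; outside this range `F^{k,l} = 0` by
convention.  Such a section is a family of bilinear maps `⋀^k T_pM × ⋀^l T_pM → ⋀^{k+l-1} T_pM`
that sends smooth multivector fields to smooth multivector fields. -/
structure TwistFields (n : ℕ) (M : Type*) [TopologicalSpace M]
    [ChartedSpace (EuclideanSpace ℝ (Fin n)) M] where
  toFun : ∀ (k l : ℕ) (p : M), ⋀[ℝ]^k (TangentSpace (𝓡 n) p) →ₗ[ℝ]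
    ⋀[ℝ]^l (TangentSpace (𝓡 n) p) →ₗ[ℝ] ⋀[ℝ]^(k + l - 1) (TangentSpace (𝓡 n) p)
  smooth : ∀ (k l : ℕ) (X Y : MVField n M) (hX : X ∈ KVField n M k) (hY : Y ∈ KVField n M l),
    IsSmoothMV n M (fun p ↦ (toFun k l p ⟨X.1 p, hX p⟩ ⟨Y.1 p, hY p⟩ :
      ExteriorAlgebra ℝ (TangentSpace (𝓡 n) p)))
  one_one : ∀ p, toFun 1 1 p = 0
  eq_zero : ∀ (k l : ℕ) (p : M), k = 0 ∨ l = 0 ∨ n < k + l - 1 → toFun k l p = 0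

/-- The multivector field `F^{k,l}(X, Y)`. -/
def TwistFields.app {n : ℕ} {M : Type*} [TopologicalSpace M]
    [ChartedSpace (EuclideanSpace ℝ (Fin n)) M] (F : TwistFields n M) {k l : ℕ}
    (X : KVField n M k) (Y : KVField n M l) : MVField n M :=
  ⟨fun p ↦ F.toFun k l p ⟨X.1.1 p, X.2 p⟩ ⟨Y.1.1 p, Y.2 p⟩, F.smooth k l X.1 Y.1 X.2 Y.2⟩

/-- `(D, F)` is the pair associated with the higher connection `C`: `C_X Y = D_X Y + F^{k,l}(X, Y)`
for all `X ∈ A^k(M)`, `Y ∈ A^l(M)`.  Here `Dt` is the induced higher connection of `D`. -/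
def HigherConnection.HasData {n : ℕ} {M : Type*} [TopologicalSpace M]
    [ChartedSpace (EuclideanSpace ℝ (Fin n)) M] [IsManifold (𝓡 n) ∞ M] (C : HigherConnection n M)
    (D : CovariantDerivative (𝓡 n) (EuclideanSpace ℝ (Fin n))
      (fun p : M ↦ TangentSpace (𝓡 n) p))
    (Dt : HigherConnection n M) (F : TwistFields n M) : Prop :=
  CovariantDerivative.ContMDiffCovariantDerivative D ∞ ∧ Dt.IsInducedBy D ∧
    ∀ (k l : ℕ) (X : KVField n M k) (Y : KVField n M l),
      C.toFun X Y = Dt.toFun X Y + F.app X Y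

/-! ### Differential forms

A form is a section of `(⋀ TM)* ≅ ⋀ T*M`; a `t`-form `α` is evaluated on `t`-vectors by
`α (v₁ ∧ ⋯ ∧ v_t) = α (v₁, …, v_t)` and vanishes on `j`-vectors with `j ≠ t`. -/

/-- Not necessarily smooth, not necessarily homogeneous forms on `M`. -/
abbrev Form (n : ℕ) (M : Type*) [TopologicalSpace M]
    [ChartedSpace (EuclideanSpace ℝ (Fin n)) M] : Type _ :=
  ∀ p : M, Module.Dual ℝ (ExteriorAlgebra ℝ (TangentSpace (𝓡 n) p))

/-- `Ω^t(M)`: the smooth `t`-forms on `M`. -/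
def DiffForm (n : ℕ) (M : Type*) [TopologicalSpace M]
    [ChartedSpace (EuclideanSpace ℝ (Fin n)) M] (t : ℕ) : Submodule ℝ (Form n M) where
  carrier := {α | (∀ j, j ≠ t → ∀ p, ∀ x ∈ ⋀[ℝ]^j (TangentSpace (𝓡 n) p), α p x = 0) ∧
    ∀ X : MVField n M, ContMDiff (𝓡 n) 𝓘(ℝ) ∞ (fun p ↦ α p (X.1 p))}
  add_mem' := by
    rintro α β ⟨h, hs⟩ ⟨h', hs'⟩
    refine ⟨fun j hj p x hx ↦ ?_, fun X ↦ ?_⟩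
    · simp [h j hj p x hx, h' j hj p x hx]
    · exact (hs X).add (hs' X)
  zero_mem' := ⟨fun _ _ _ _ _ ↦ rfl, fun _ ↦ contMDiff_const⟩
  smul_mem' := by
    rintro c α ⟨h, hs⟩
    refine ⟨fun j hj p x hx ↦ ?_, fun X ↦ ?_⟩
    · simp [h j hj p x hx]
    · exact contMDiff_const.mul (hs X)

/-- The interior product: `(i_X α)(Y) = α (X ∧ Y)`. -/
def interior {n : ℕ} {M : Type*} [TopologicalSpace M]
    [ChartedSpace (EuclideanSpace ℝ (Fin n)) M] (X : MVField n M) (α : Form n M) : Form n M :=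
  fun p ↦ α p ∘ₗ LinearMap.mulLeft ℝ (X.1 p)

/-- An alternating form on `ℝⁿ`, as a continuous alternating form. -/
def toContinuousAlternating {n j : ℕ} (f : (EuclideanSpace ℝ (Fin n)) [⋀^Fin j]→ₗ[ℝ] ℝ) :
    (EuclideanSpace ℝ (Fin n)) [⋀^Fin j]→L[ℝ] ℝ :=
  { f with
    cont := by
      let b := (EuclideanSpace.basisFun (Fin n) ℝ).toBasis
      have key : ∀ v : Fin j → EuclideanSpace ℝ (Fin n),
          f v = ∑ r : Fin j → Fin n, (∏ i, v i (r i)) * f (fun i ↦ b (r i)) := by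
        intro v
        have hv : v = fun i ↦ ∑ a, v i a • b a := by
          funext i
          conv_lhs => rw [← b.sum_repr (v i)]
          rfl
        conv_lhs => rw [hv]
        change f.toMultilinearMap _ = _
        rw [MultilinearMap.map_sum]
        refine Finset.sum_congr rfl fun r _ ↦ ?_
        rw [MultilinearMap.map_smul_univ, smul_eq_mul]
        rfl
      change Continuous (fun v ↦ f v)
      rw [funext key]
      fun_prop }

/-- The degree `j` component of a form in the chart centred at `p`. -/
def chartForm {n : ℕ} {M : Type*} [TopologicalSpace M]
    [ChartedSpace (EuclideanSpace ℝ (Fin n)) M] (α : Form n M) (j : ℕ) (p : M)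
    (y : EuclideanSpace ℝ (Fin n)) : (EuclideanSpace ℝ (Fin n)) [⋀^Fin j]→L[ℝ] ℝ :=
  toContinuousAlternating
    (((α ((extChartAt (𝓡 n) p).symm y)).compAlternatingMap
      (ExteriorAlgebra.ιMulti ℝ j)).compLinearMap (chartSymmDeriv n M p y).toLinearMap)

/-- The exterior derivative `d : Ω(M) → Ω(M)`; at `p` it is computed in the chart centred at `p`
by Mathlib's exterior derivative on `ℝⁿ`, separately in each degree. -/
def extD {n : ℕ} {M : Type*} [TopologicalSpace M]
    [ChartedSpace (EuclideanSpace ℝ (Fin n)) M] (α : Form n M) : Form n M :=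
  fun p ↦ ExteriorAlgebra.liftAlternating fun i ↦
    match i with
    | 0 => 0
    | j + 1 => (extDeriv (chartForm α j p) (extChartAt (𝓡 n) p p)).toAlternatingMap.compLinearMap
        (chartDeriv n M p p).toLinearMap

/-- The Lie derivative of a form along `X ∈ A^k(M)`: `L_X α = d i_X α - (-1)^k i_X d α`. -/
def lieD {n : ℕ} {M : Type*} [TopologicalSpace M]
    [ChartedSpace (EuclideanSpace ℝ (Fin n)) M] {k : ℕ} (X : KVField n M k) (α : Form n M) :
    Form n M :=
  extD (interior X α) - (-1 : ℝ) ^ k • interior X (extD α)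

/-- The function `(C_X α)(Y)` for `X ∈ A^k(M)`, `α ∈ Ω^l(M)`, `Y ∈ A^{l-k+1}(M)`: for `k > 0` and
`l - k + 1 ≥ 0` it is `(-1)^((k-1)(l-1)) L_X i_Y α - α(C_X Y)`, and otherwise `C_X α = 0`.
The function `L_X i_Y α ∈ Ω^0(M)` is read off by evaluation at `1 ∈ ⋀^0 T_pM`. -/
def HigherConnection.covDerivForm {n : ℕ} {M : Type*} [TopologicalSpace M]
    [ChartedSpace (EuclideanSpace ℝ (Fin n)) M] (C : HigherConnection n M) {k l m : ℕ}
    (X : KVField n M k) (α : DiffForm n M l) (Y : KVField n M m) (p : M) : ℝ :=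
  if 0 < k ∧ m + k = l + 1 then
    (-1 : ℝ) ^ (((k : ℤ) - 1) * ((l : ℤ) - 1)) * lieD X (interior Y.1 α.1) p 1
      - α.1 p ((C.toFun X Y).1 p)
  else 0

/-! ### Associative bilinear forms -/

/-- The set `ℬ(M)` of smooth associative bilinear forms on `⋀ TM`. -/
structure AssocForm (n : ℕ) (M : Type*) [TopologicalSpace M]
    [ChartedSpace (EuclideanSpace ℝ (Fin n)) M] where
  toFun : ∀ p : M, ExteriorAlgebra ℝ (TangentSpace (𝓡 n) p) →ₗ[ℝ]
    ExteriorAlgebra ℝ (TangentSpace (𝓡 n) p) →ₗ[ℝ] ℝ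
  assoc : ∀ (p : M) (k l m : ℕ), ∀ x ∈ ⋀[ℝ]^k (TangentSpace (𝓡 n) p),
    ∀ y ∈ ⋀[ℝ]^l (TangentSpace (𝓡 n) p), ∀ z ∈ ⋀[ℝ]^m (TangentSpace (𝓡 n) p),
      toFun p (x * y) z = toFun p x (y * z)
  smooth : ∀ k l : ℕ, ∀ X ∈ KVField n M k, ∀ Y ∈ KVField n M l,
    ContMDiff (𝓡 n) 𝓘(ℝ) ∞ (fun p ↦ toFun p (X.1 p) (Y.1 p))

/-- Taking the degree `t` component commutes with the maps induced on exterior algebras. -/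
theorem map_proj {V W : Type*} [AddCommGroup V] [Module ℝ V] [AddCommGroup W] [Module ℝ W]
    (f : V →ₗ[ℝ] W) (t : ℕ) (x : ExteriorAlgebra ℝ V) :
    ExteriorAlgebra.map f (GradedAlgebra.proj (fun i ↦ ⋀[ℝ]^i V) t x) =
      GradedAlgebra.proj (fun i ↦ ⋀[ℝ]^i W) t (ExteriorAlgebra.map f x) := by
  induction x using DirectSum.Decomposition.inductionOn (fun i ↦ ⋀[ℝ]^i V) with
  | zero => simp
  | add a b ha hb => simp only [map_add, ha, hb]
  | @homogeneous j a =>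
    have hfa : ExteriorAlgebra.map f (a : ExteriorAlgebra ℝ V) ∈ ⋀[ℝ]^j W := by
      have h : (⋀[ℝ]^j V).map (ExteriorAlgebra.map f).toLinearMap ≤ ⋀[ℝ]^j W := by
        rw [← ExteriorAlgebra.ιMulti_span_fixedDegree, Submodule.map_span_le]
        rintro _ ⟨v, rfl⟩
        simp only [AlgHom.toLinearMap_apply, ExteriorAlgebra.map_apply_ιMulti]
        rw [← ExteriorAlgebra.ιMulti_span_fixedDegree]
        exact Submodule.subset_span ⟨_, rfl⟩
      exact h ⟨_, a.2, rfl⟩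
    simp only [GradedAlgebra.proj_apply]
    by_cases hj : j = t
    · subst hj
      rw [DirectSum.decompose_of_mem_same (fun i ↦ ⋀[ℝ]^i V) a.2,
        DirectSum.decompose_of_mem_same (fun i ↦ ⋀[ℝ]^i W) hfa]
    · rw [DirectSum.decompose_of_mem_ne (fun i ↦ ⋀[ℝ]^i V) a.2 hj,
        DirectSum.decompose_of_mem_ne (fun i ↦ ⋀[ℝ]^i W) hfa hj, map_zero]

/-- The degree `t` component of a multivector field. -/
def component {n : ℕ} {M : Type*} [TopologicalSpace M]
    [ChartedSpace (EuclideanSpace ℝ (Fin n)) M] (t : ℕ) (X : MVField n M) : MVField n M :=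
  ⟨fun p ↦ GradedAlgebra.proj (fun i ↦ ⋀[ℝ]^i (TangentSpace (𝓡 n) p)) t (X.1 p), by
    intro p φ
    simp only [map_proj]
    exact X.2 p (φ ∘ₗ GradedAlgebra.proj (fun i ↦ ⋀[ℝ]^i (EuclideanSpace ℝ (Fin n))) t)⟩

/-- The `t`-form `η^{(t)}` associated with `η`, given by `η^{(t)}(x) = η(x, 1)` for
`x ∈ ⋀^t T_pM`. -/
def AssocForm.form {n : ℕ} {M : Type*} [TopologicalSpace M]
    [ChartedSpace (EuclideanSpace ℝ (Fin n)) M] (η : AssocForm n M) (t : ℕ) : DiffForm n M t :=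
  ⟨fun p ↦ (η.toFun p).flip 1 ∘ₗ
      GradedAlgebra.proj (fun i ↦ ⋀[ℝ]^i (TangentSpace (𝓡 n) p)) t, by
    refine ⟨fun j hj p x hx ↦ ?_, fun X ↦ ?_⟩
    · rw [LinearMap.comp_apply, GradedAlgebra.proj_apply,
        DirectSum.decompose_of_mem_ne (fun i ↦ ⋀[ℝ]^i (TangentSpace (𝓡 n) p)) hx hj, map_zero]
    · refine η.smooth t 0 (component t X) (fun p ↦ ?_) 1 (fun p ↦ ?_)
      · exact SetLike.coe_mem _
      · exact SetLike.GradedOne.one_mem⟩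

/-- The forms associated with `η` recover `η`: `η(x, y) = η^{(k+l)}(x ∧ y)` for `x ∈ ⋀^k T_pM` and
`y ∈ ⋀^l T_pM`. -/
theorem AssocForm.apply_eq_form {n : ℕ} {M : Type*} [TopologicalSpace M]
    [ChartedSpace (EuclideanSpace ℝ (Fin n)) M] (η : AssocForm n M) (p : M) (k l : ℕ)
    (x : ExteriorAlgebra ℝ (TangentSpace (𝓡 n) p)) (hx : x ∈ ⋀[ℝ]^k (TangentSpace (𝓡 n) p))
    (y : ExteriorAlgebra ℝ (TangentSpace (𝓡 n) p)) (hy : y ∈ ⋀[ℝ]^l (TangentSpace (𝓡 n) p)) :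
    η.toFun p x y = (η.form (k + l)).1 p (x * y) := by
  have h : x * y ∈ ⋀[ℝ]^(k + l) (TangentSpace (𝓡 n) p) :=
    SetLike.GradedMul.mul_mem (A := fun i ↦ ⋀[ℝ]^i (TangentSpace (𝓡 n) p)) hx hy
  change _ = η.toFun p (GradedAlgebra.proj (fun i ↦ ⋀[ℝ]^i (TangentSpace (𝓡 n) p)) (k + l) (x * y)) 1
  rw [GradedAlgebra.proj_apply, DirectSum.decompose_of_mem_same
    (fun i ↦ ⋀[ℝ]^i (TangentSpace (𝓡 n) p)) h,
    η.assoc p k l 0 x hx y hy 1 (SetLike.GradedOne.one_mem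
      (A := fun i ↦ ⋀[ℝ]^i (TangentSpace (𝓡 n) p))), mul_one]

/-- The exterior product `A^k(M) × A^l(M) → A^{k+l}(M)`. -/
def wedge {n : ℕ} {M : Type*} [TopologicalSpace M]
    [ChartedSpace (EuclideanSpace ℝ (Fin n)) M] {k l : ℕ}
    (X : KVField n M k) (Y : KVField n M l) : KVField n M (k + l) :=
  ⟨X.1 * Y.1, fun p ↦ SetLike.GradedMul.mul_mem
    (A := fun i ↦ ⋀[ℝ]^i (TangentSpace (𝓡 n) p)) (X.2 p) (Y.2 p)⟩

/-- The function `(C_X η)(Y, Z) = (C_X η^{(t)})(Y ∧ Z)`, where `t = k + l + m - 1`, for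
`X ∈ A^k(M)`, `Y ∈ A^l(M)`, `Z ∈ A^m(M)`. -/
def HigherConnection.covDerivAssoc {n : ℕ} {M : Type*} [TopologicalSpace M]
    [ChartedSpace (EuclideanSpace ℝ (Fin n)) M] (C : HigherConnection n M) (η : AssocForm n M)
    {k l m : ℕ} (X : KVField n M k) (Y : KVField n M l) (Z : KVField n M m) (p : M) : ℝ :=
  C.covDerivForm X (η.form (k + l + m - 1)) (wedge Y Z) p

/-- `C η ≡ 0`: the form `η` is parallel with respect to `C`. -/
def HigherConnection.IsParallel {n : ℕ} {M : Type*} [TopologicalSpace M]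
    [ChartedSpace (EuclideanSpace ℝ (Fin n)) M] (C : HigherConnection n M)
    (η : AssocForm n M) : Prop :=
  ∀ k l m : ℕ, 0 < k → 0 < l + m → k + l + m ≤ n + 1 →
    ∀ (X : KVField n M k) (Y : KVField n M l) (Z : KVField n M m) (p : M),
      C.covDerivAssoc η X Y Z p = 0

end HigherConnections

end

namespace HigherConnections

variable {n : ℕ} {M : Type*} [TopologicalSpace M] [ChartedSpace (EuclideanSpace ℝ (Fin n)) M]

theorem one_mem_kvField_zero : (1 : MVField n M) ∈ KVField n M 0 := fun p ↦
  SetLike.GradedOne.one_mem (A := fun i ↦ ⋀[ℝ]^i (TangentSpace (𝓡 n) p))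

theorem wedge_one {k : ℕ} (X : KVField n M k) : wedge X ⟨1, one_mem_kvField_zero⟩ = X :=
  Subtype.ext (mul_one X.1)

namespace HigherConnection

-- The Lie derivative term of `∇_X α` does not involve the connection, so it cancels.
theorem covDerivForm_sub_covDerivForm (B C : HigherConnection n M) {k t l : ℕ} (hk : 0 < k)
    (ht : l + k = t + 1) (X : KVField n M k) (α : DiffForm n M t) (Y : KVField n M l) (p : M) :
    B.covDerivForm X α Y p - C.covDerivForm X α Y p =
      α.1 p ((C.toFun X Y - B.toFun X Y).1 p) := by
  have hpt : (C.toFun X Y - B.toFun X Y).1 p = (C.toFun X Y).1 p - (B.toFun X Y).1 p := rfl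
  simp only [covDerivForm, hk, ht, and_self, if_true]
  rw [hpt, map_sub, sub_sub_sub_cancel_left]

theorem isParallel_iff_covDerivForm_form_eq_zero (C : HigherConnection n M) (η : AssocForm n M) :
    C.IsParallel η ↔ ∀ k l : ℕ, 0 < k → 0 < l → k + l - 1 ≤ n →
      ∀ (X : KVField n M k) (Y : KVField n M l) (p : M),
        C.covDerivForm X (η.form (k + l - 1)) Y p = 0 := by
  constructor
  · intro hpar k l hk hl hkl X Y p
    rw [← wedge_one Y]
    exact hpar k l 0 hk hl (Nat.sub_le_iff_le_add.mp hkl) X Y ⟨1, one_mem_kvField_zero⟩ p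
  · intro hform k l m hk hlm hklm X Y Z p
    rw [covDerivAssoc, Nat.add_assoc k l m]
    exact hform k (l + m) hk hlm (by omega) X (wedge Y Z) p

theorem HasData.app_eq_sub [IsManifold (𝓡 n) ∞ M] {C Dt : HigherConnection n M}
    {D : CovariantDerivative (𝓡 n) (EuclideanSpace ℝ (Fin n)) (fun p : M ↦ TangentSpace (𝓡 n) p)}
    {F : TwistFields n M} (hdata : C.HasData D Dt F) {k l : ℕ} (X : KVField n M k)
    (Y : KVField n M l) : F.app X Y = C.toFun X Y - Dt.toFun X Y :=
  eq_sub_of_add_eq' (hdata.2.2 k l X Y).symm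

end HigherConnection

end HigherConnections

theorem mainTheorem11_general {n : ℕ} {M : Type*} [TopologicalSpace M]
    [ChartedSpace (EuclideanSpace ℝ (Fin n)) M]
    (η : HigherConnections.AssocForm n M) (B C : HigherConnections.HigherConnection n M) :
    C.IsParallel η ↔
      ∀ k l : ℕ, 0 < k → 0 < l → k + l - 1 ≤ n →
        ∀ (X : HigherConnections.KVField n M k) (Y : HigherConnections.KVField n M l) (p : M),
          B.covDerivForm X (η.form (k + l - 1)) Y p =
            (η.form (k + l - 1)).1 p ((C.toFun X Y - B.toFun X Y).1 p) := by
  rw [C.isParallel_iff_covDerivForm_form_eq_zero]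
  refine forall₂_congr fun k l ↦ forall₃_congr fun hk hl _ ↦ forall₃_congr fun X Y p ↦ ?_
  rw [← B.covDerivForm_sub_covDerivForm C hk (by omega)]
  exact sub_eq_self.symm.trans eq_comm

theorem mainTheorem11 (n : ℕ) (M : Type*) [TopologicalSpace M] [T2Space M]
    [SecondCountableTopology M] [ChartedSpace (EuclideanSpace ℝ (Fin n)) M]
    [IsManifold (𝓡 n) ∞ M]
    (η : HigherConnections.AssocForm n M)
    (nabla : HigherConnections.HigherConnection n M)
    (D : CovariantDerivative (𝓡 n) (EuclideanSpace ℝ (Fin n))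
      (fun p : M ↦ TangentSpace (𝓡 n) p))
    (Dt : HigherConnections.HigherConnection n M)
    (F : HigherConnections.TwistFields n M)
    (hdata : nabla.HasData D Dt F) :
    nabla.IsParallel η ↔
      ∀ k l : ℕ, 0 < k → 0 < l → k + l - 1 ≤ n →
        ∀ (X : HigherConnections.KVField n M k) (Y : HigherConnections.KVField n M l) (p : M),
          Dt.covDerivForm X (η.form (k + l - 1)) Y p =
            (η.form (k + l - 1)).1 p ((F.app X Y).1 p) := by
  simpa only [hdata.app_eq_sub] using mainTheorem11_general η Dt nabla
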